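/- For an infinite word $\mathbf{x}\in\{0,1\}^{\mathbb{N}}$, its factors are the finite words of consecutive letters of $\mathbf{x}$, and the weight of a finite word $v$ is the number $|v|_1$ of its letters equal to $1$. The word $\mathbf{x}$ is uniformly recurrent if for each factor $u$ of $\mathbf{x}$ there is $N$ such that every length-$N$ factor of $\mathbf{x}$ contains $u$. It has uniform frequency $\alpha$ of the letter $1$ if both the maximum and the minimum of $|v|_1/n$ over the length-$n$ factors $v$ of $\mathbf{x}$ tend to $\alpha$ as $n\to\infty$. The abelian closure $\mathcal{A}_{\mathbf{x}}$ is the set of all $\mathbf{y}\in\{0,1\}^{\mathbb{N}}$ such that for every factor $u$ of $\mathbf{y}$ there is a factor $v$ of $\mathbf{x}$ with $|u|_0=|v|_0$ and $|u|_1=|v|_1$. A subshift is a non-empty subset $X$ of $\{0,1\}^{\mathbb{N}}$ that is closed in the product topology and satisfies $\sigma(X)\subseteq X$, where $\sigma(a_0a_1a_2\cdots)=a_1a_2\cdots$; it is minimal if it does not properly contain any subshift. **Proposition.** Let $\mathbf{x}\in\{0,1\}^{\mathbb{N}}$ be uniformly recurrent with uniform frequency $\alpha$ of the letter $1$, where $\alpha$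 is irrational. Assume that there is $n_0\in\mathbb{N}$ such that, for each $n\ge n_0$, $\mathbf{x}$ has a factor of length $n$ and weight $\lceil n\alpha\rceil+1$ and a factor of length $n$ and weight $\lfloor n\alpha\rfloor-1$. Then the abelian closure $\mathcal{A}_{\mathbf{x}}$ contains uncountably many minimal subshifts. -/

import Mathlib

open Filter Topology
open SymbolicDynamics.FullShift (Subshift)

/-- The factor of length `n` of the infinite word `x` starting at position `i`. -/
def factorAt {A : Type*} (x : ℕ → A) (i n : ℕ) : List A :=
  List.ofFn fun j : Fin n => x (i + j)

/-- The language of an infinite word: the set of all its (finite) factors. -/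
def language {A : Type*} (x : ℕ → A) : Set (List A) :=
  {v | ∃ i n : ℕ, v = factorAt x i n}

/-- The set of factors of length `n` of an infinite word. -/
def languageOfLength {A : Type*} (x : ℕ → A) (n : ℕ) : Set (List A) :=
  {v | v ∈ language x ∧ v.length = n}

/-- The Parikh vector of a finite word. -/
def parikh {A : Type*} [DecidableEq A] (v : List A) : A → ℕ :=
  fun a => v.count a

/-- The abelian language: the set of Parikh vectors of factors. -/
def abelianLanguage {A : Type*} [DecidableEq A] (x : ℕ → A) : Set (A → ℕ) :=
  parikh '' language x

/-- The abelian closure of an infinite word. -/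
def abelianClosure {A : Type*} [DecidableEq A] (x : ℕ → A) : Set (ℕ → A) :=
  {y | abelianLanguage y ⊆ abelianLanguage x}

/-- Each factor `u` of `x` occurs with bounded gaps: for some `N`, every factor of length `N`
contains `u`. -/
def UniformlyRecurrent {A : Type*} (x : ℕ → A) : Prop :=
  ∀ u ∈ language x, ∃ N : ℕ, ∀ v ∈ languageOfLength x N, u <:+: v

/-- The largest number of occurrences of `a` in a length-`n` factor
(a supremum of a non-empty set of naturals that is bounded by `n`, hence a maximum). -/
noncomputable def maxCount {A : Type*} [DecidableEq A] (x : ℕ → A) (a : A) (n : ℕ) : ℕ :=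
  sSup ((fun v : List A => v.count a) '' languageOfLength x n)

/-- The smallest number of occurrences of `a` in a length-`n` factor. -/
noncomputable def minCount {A : Type*} [DecidableEq A] (x : ℕ → A) (a : A) (n : ℕ) : ℕ :=
  sInf ((fun v : List A => v.count a) '' languageOfLength x n)

/-- `x` has uniform frequency `α` of the letter `a`: the upper and the lower frequency of `a`
are both equal to `α`. -/
def HasUniformFreq {A : Type*} [DecidableEq A] (x : ℕ → A) (a : A) (α : ℝ) : Prop :=
  Tendsto (fun n : ℕ => (maxCount x a n : ℝ) / n) atTop (𝓝 α) ∧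
  Tendsto (fun n : ℕ => (minCount x a n : ℝ) / n) atTop (𝓝 α)

/-- The weight of a finite binary word: its number of ones. -/
def weight (v : List (Fin 2)) : ℕ :=
  v.count 1

/-- A minimal one-sided subshift: it is non-empty and contains no non-empty subshift other than
itself. -/
def IsMinimalSubshift {A : Type*} [TopologicalSpace A] (X : Subshift A ℕ) : Prop :=
  X.carrier.Nonempty ∧
    ∀ Y : Subshift A ℕ, Y.carrier.Nonempty → Y.carrier ⊆ X.carrier → Y.carrier = X.carrier

/-! Put F(t) = ⌊t⌋ + 1 if the fractional part of t lies in [u, v), and F(t) = ⌊t⌋ otherwise. The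
increments of F along the multiples of α form a binary word whose factors weigh F(t + nα) - F(t).
Since F(t) - t lies in (-1, 1 - u], these weights differ from nα by less than 2, so the hypothesis
on `x` covers all lengths n ≥ n₀. For u close to 1 the finitely many shorter lengths only show the
weights ⌊nα⌋ and ⌈nα⌉, which the frequency of `x` forces to occur
(`rotationWord_mem_abelianClosure`). Right-continuity of F and bounded return times of the rotation
make the word uniformly recurrent, so it generates a minimal subshift. The supremum of weight minus
nα over its factors is 2 - u, so an interval of parameters u yields pairwise distinct subshifts
(`subshiftOfWord_rotationWord_injOn`). -/

section Words

/-! ### Factors, languages and minimal subshifts. -/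

variable {A : Type*}

theorem length_factorAt (x : ℕ → A) (i n : ℕ) : (factorAt x i n).length = n := by
  simp [factorAt]

theorem factorAt_mem_language (x : ℕ → A) (i n : ℕ) : factorAt x i n ∈ language x :=
  ⟨i, n, rfl⟩

theorem mem_languageOfLength {x : ℕ → A} {n : ℕ} {v : List A} :
    v ∈ languageOfLength x n ↔ ∃ i, v = factorAt x i n := by
  constructor
  · rintro ⟨⟨i, m, rfl⟩, h⟩
    rw [length_factorAt] at h
    exact ⟨i, by rw [h]⟩
  · rintro ⟨i, rfl⟩
    exact ⟨factorAt_mem_language x i n, length_factorAt x i n⟩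

theorem factorAt_congr {x y : ℕ → A} {i j n : ℕ} (h : ∀ m < n, x (i + m) = y (j + m)) :
    factorAt x i n = factorAt y j n := by
  unfold factorAt
  exact congrArg List.ofFn (funext fun m => h m m.2)

theorem eq_of_factorAt_eq {x y : ℕ → A} {i j n : ℕ} (h : factorAt x i n = factorAt y j n)
    {m : ℕ} (hm : m < n) : x (i + m) = y (j + m) :=
  congrFun (List.ofFn_injective h) ⟨m, hm⟩

theorem factorAt_add (x : ℕ → A) (i a b : ℕ) :
    factorAt x i (a + b) = factorAt x i a ++ factorAt x (i + a) b := by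
  simp [factorAt, List.ofFn_add, Nat.add_assoc]

theorem factorAt_shift (x : ℕ → A) (k i n : ℕ) :
    factorAt (SymbolicDynamics.FullShift.shift k x) i n = factorAt x (k + i) n :=
  factorAt_congr fun m _ => by simp [SymbolicDynamics.FullShift.shift_apply, Nat.add_assoc]

theorem factorAt_infix (x : ℕ → A) {i j m n : ℕ} (hij : i ≤ j) (h : j + m ≤ i + n) :
    factorAt x j m <:+: factorAt x i n := by
  obtain ⟨a, rfl⟩ := Nat.exists_eq_add_of_le hij
  obtain ⟨b, hb⟩ := Nat.exists_eq_add_of_le h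
  obtain rfl : n = a + m + b := by omega
  exact ⟨factorAt x i a, factorAt x (i + (a + m)) b, by rw [factorAt_add, factorAt_add]⟩

theorem mem_language_of_infix {x : ℕ → A} {v w : List A} (hw : w ∈ language x)
    (h : v <:+: w) : v ∈ language x := by
  obtain ⟨i, n, rfl⟩ := hw
  obtain ⟨s, t, h⟩ := h
  have hn : n = s.length + v.length + t.length := by
    rw [← length_factorAt x i n, ← h]; simp [Nat.add_assoc]
  subst hn
  rw [factorAt_add, factorAt_add] at h
  have h1 := (List.append_inj h (by simp [length_factorAt])).1
  have h2 := (List.append_inj h1 (by simp [length_factorAt])).2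
  exact ⟨_, _, h2⟩

variable [TopologicalSpace A]

/-- A word whose prefixes are all realized by members of a closed set belongs to that set. -/
theorem mem_of_forall_prefix {K : Set (ℕ → A)} (hK : IsClosed K) {x : ℕ → A}
    (h : ∀ n, ∃ z ∈ K, ∀ m < n, z m = x m) : x ∈ K := by
  rw [← hK.closure_eq, mem_closure_iff_nhds]
  intro U hU
  rw [nhds_pi, Filter.mem_pi] at hU
  obtain ⟨I, hI, t, ht, hsub⟩ := hU
  obtain ⟨N, hN⟩ := hI.bddAbove
  obtain ⟨z, hz, hzx⟩ := h (N + 1)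
  refine ⟨z, hsub fun i hi => ?_, hz⟩
  rw [hzx i (Nat.lt_succ_of_le (hN hi))]
  exact mem_of_mem_nhds (ht i)

variable [DiscreteTopology A]

theorem isOpen_setOf_agree (x : ℕ → A) (n : ℕ) :
    IsOpen {z : ℕ → A | ∀ m < n, z m = x m} := by
  have : {z : ℕ → A | ∀ m < n, z m = x m} = ⋂ m ∈ Set.Iio n, {z | z m = x m} := by
    ext z; simp
  rw [this]
  exact (Set.finite_Iio n).isOpen_biInter fun m _ =>
    (isOpen_discrete ({x m} : Set A)).preimage (continuous_apply (A := fun _ => A) m)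

/-- The subshift of all words whose factors are factors of `y`. -/
def subshiftOfWord (y : ℕ → A) : Subshift A ℕ where
  carrier := {z | language z ⊆ language y}
  isClosed := by
    rw [← isOpen_compl_iff, isOpen_iff_mem_nhds]
    intro z hz
    obtain ⟨v, ⟨i, n, rfl⟩, hv⟩ := Set.not_subset.1 hz
    refine Filter.mem_of_superset ((isOpen_setOf_agree z (i + n)).mem_nhds fun m _ => rfl) ?_
    intro z' hz' hsub
    refine hv (hsub ⟨i, n, factorAt_congr fun m hm => (hz' (i + m) (by omega)).symm⟩)
  mapsTo := by
    rintro k z hz v ⟨i, n, rfl⟩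
    rw [factorAt_shift]
    exact hz (factorAt_mem_language z _ _)

theorem self_mem_subshiftOfWord (y : ℕ → A) : y ∈ (subshiftOfWord y).carrier :=
  fun _ h => h

/-- A long factor of any point z of a smaller subshift is a factor of `y`, hence contains any
prescribed factor of `y`. So z has the full language of `y`, and every point of the orbit closure is
a limit of shifts of z. -/
theorem UniformlyRecurrent.isMinimalSubshift {y : ℕ → A} (hy : UniformlyRecurrent y) :
    IsMinimalSubshift (subshiftOfWord y) := by
  refine ⟨⟨y, self_mem_subshiftOfWord y⟩, fun Y ⟨z, hz⟩ hY => hY.antisymm fun w hw => ?_⟩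
  have hyz : language y ⊆ language z := by
    intro v hv
    obtain ⟨N, hN⟩ := hy v hv
    have h0 := factorAt_mem_language z 0 N
    exact mem_language_of_infix h0 (hN _ ⟨hY hz h0, length_factorAt z 0 N⟩)
  refine mem_of_forall_prefix Y.isClosed fun n => ?_
  obtain ⟨i, m, h⟩ := hyz (hw (factorAt_mem_language w 0 n))
  obtain rfl : n = m := by
    have := congrArg List.length h
    simpa only [length_factorAt] using this
  refine ⟨SymbolicDynamics.FullShift.shift i z, Y.mapsTo i hz, fun k hk => ?_⟩
  have := eq_of_factorAt_eq h hk
  rw [SymbolicDynamics.FullShift.shift_apply, ← this, Nat.zero_add]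

theorem subshiftOfWord_subset_abelianClosure [DecidableEq A] {x y : ℕ → A}
    (hy : y ∈ abelianClosure x) : (subshiftOfWord y).carrier ⊆ abelianClosure x := by
  rintro z hz _ ⟨v, hv, rfl⟩
  exact hy ⟨v, hz hv, rfl⟩

end Words

/-! ### Weights of binary factors and uniform frequency. -/

section Weight

theorem weight_append (v w : List (Fin 2)) : weight (v ++ w) = weight v + weight w :=
  List.count_append

theorem weight_le_length (v : List (Fin 2)) : weight v ≤ v.length :=
  List.count_le_length

theorem weight_factorAt_one (x : ℕ → Fin 2) (i : ℕ) :
    weight (factorAt x i 1) = if x i = 1 then 1 else 0 := by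
  simp [factorAt, weight, List.count_singleton]

theorem parikh_eq_of_weight_eq {v w : List (Fin 2)} (hl : v.length = w.length)
    (hw : weight v = weight w) : parikh v = parikh w := by
  have key : ∀ u : List (Fin 2), u.count 0 + u.count 1 = u.length := by
    intro u
    induction u with
    | nil => simp
    | cons a u ih =>
      fin_cases a <;> simp <;> omega
  have h1 := key v
  have h2 := key w
  unfold weight at hw
  funext a
  fin_cases a
  · change v.count 0 = w.count 0
    omega
  · exact hw

theorem weight_factorAt_succ (x : ℕ → Fin 2) (i n : ℕ) :
    weight (factorAt x (i + 1) n) ≤ weight (factorAt x i n) + 1 ∧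
      weight (factorAt x i n) ≤ weight (factorAt x (i + 1) n) + 1 := by
  have h1 := congrArg weight (factorAt_add x i n 1)
  have h2 := congrArg weight (factorAt_add x i 1 n)
  rw [Nat.add_comm 1 n] at h2
  rw [h1, weight_append, weight_append, weight_factorAt_one, weight_factorAt_one] at h2
  split_ifs at h2 <;> omega

/-- A sequence of integers with steps of size at most one attains all intermediate values. -/
theorem exists_eq_of_steps {f : ℕ → ℤ} (hf : ∀ i, f (i + 1) ≤ f i + 1 ∧ f i ≤ f (i + 1) + 1)
    {i j : ℕ} {k : ℤ} (hi : f i ≤ k) (hj : k ≤ f j) : ∃ l, f l = k := by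
  have up : ∀ (d i : ℕ), f i ≤ k → k ≤ f (i + d) → ∃ l, f l = k := by
    intro d
    induction d with
    | zero => exact fun i h1 h2 => ⟨i, le_antisymm h1 h2⟩
    | succ d ih =>
      intro i h1 h2
      rcases h1.eq_or_lt with h | h
      · exact ⟨i, h⟩
      · exact ih (i + 1) (by have := hf i; omega) (by rwa [Nat.add_right_comm, Nat.add_assoc])
  have down : ∀ (d j : ℕ), k ≤ f j → f (j + d) ≤ k → ∃ l, f l = k := by
    intro d
    induction d with
    | zero => exact fun i h1 h2 => ⟨i, le_antisymm h2 h1⟩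
    | succ d ih =>
      intro i h1 h2
      rcases h1.eq_or_lt with h | h
      · exact ⟨i, h.symm⟩
      · exact ih (i + 1) (by have := hf i; omega) (by rwa [Nat.add_right_comm, Nat.add_assoc])
  rcases le_total i j with h | h
  · exact up (j - i) i hi (by rwa [Nat.add_sub_cancel' h])
  · exact down (i - j) j hj (by rwa [Nat.add_sub_cancel' h])

/-- Sliding a window by one letter changes its weight by at most one. -/
theorem exists_factor_weight_eq {x : ℕ → Fin 2} {n i j : ℕ} {k : ℤ}
    (hi : (weight (factorAt x i n) : ℤ) ≤ k) (hj : k ≤ weight (factorAt x j n)) :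
    ∃ l, (weight (factorAt x l n) : ℤ) = k :=
  exists_eq_of_steps (f := fun i => (weight (factorAt x i n) : ℤ))
    (fun i => by have := weight_factorAt_succ x i n; omega) hi hj

/-- If every factor of length `n` of `y` has the weight of some factor of length `n` of `x`, then
`y` lies in the abelian closure of `x`. -/
theorem mem_abelianClosure_of_weight {x y : ℕ → Fin 2}
    (h : ∀ i n, ∃ l, weight (factorAt x l n) = weight (factorAt y i n)) :
    y ∈ abelianClosure x := by
  rintro _ ⟨_, ⟨i, n, rfl⟩, rfl⟩
  obtain ⟨l, hl⟩ := h i n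
  exact ⟨_, factorAt_mem_language x l n,
    parikh_eq_of_weight_eq (by simp only [length_factorAt]) hl⟩

theorem weight_le_maxCount (x : ℕ → Fin 2) (i n : ℕ) :
    weight (factorAt x i n) ≤ maxCount x 1 n := by
  refine le_csSup ⟨n, ?_⟩ ⟨_, mem_languageOfLength.2 ⟨i, rfl⟩, rfl⟩
  rintro _ ⟨v, hv, rfl⟩
  exact (weight_le_length v).trans hv.2.le

theorem minCount_le_weight (x : ℕ → Fin 2) (i n : ℕ) :
    minCount x 1 n ≤ weight (factorAt x i n) :=
  Nat.sInf_le ⟨_, mem_languageOfLength.2 ⟨i, rfl⟩, rfl⟩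

theorem tendsto_weight_div {x : ℕ → Fin 2} {α : ℝ} (h : HasUniformFreq x 1 α) :
    Tendsto (fun n : ℕ => (weight (factorAt x 0 n) : ℝ) / n) atTop (𝓝 α) := by
  refine tendsto_of_tendsto_of_tendsto_of_le_of_le h.2 h.1 (fun n => ?_) (fun n => ?_)
  · exact div_le_div_of_nonneg_right (Nat.cast_le.2 (minCount_le_weight x 0 n)) n.cast_nonneg
  · exact div_le_div_of_nonneg_right (Nat.cast_le.2 (weight_le_maxCount x 0 n)) n.cast_nonneg

theorem tendsto_weight_mul_div {x : ℕ → Fin 2} {α : ℝ} (h : HasUniformFreq x 1 α) {n : ℕ}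
    (hn : 0 < n) :
    Tendsto (fun k : ℕ => (weight (factorAt x 0 (n * k)) : ℝ) / k) atTop (𝓝 (n * α)) := by
  have h1 := ((tendsto_weight_div h).comp
    (tendsto_id.const_mul_atTop' hn : Tendsto (fun k : ℕ => n * k) atTop atTop)).const_mul (n : ℝ)
  refine h1.congr fun k => ?_
  have : (n : ℝ) ≠ 0 := by positivity
  rcases Nat.eq_zero_or_pos k with rfl | hk
  · simp
  · have : (k : ℝ) ≠ 0 := by positivity
    simp only [Function.comp]
    push_cast
    field_simp

/-- Otherwise cutting a prefix into blocks of length `n` would give frequency at least c / n > α. -/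
theorem exists_weight_le {x : ℕ → Fin 2} {α : ℝ} (h : HasUniformFreq x 1 α) {n : ℕ}
    (hn : 0 < n) {c : ℝ} (hc : n * α < c) : ∃ i, (weight (factorAt x i n) : ℝ) < c := by
  by_contra! hcon
  have hk : ∀ k : ℕ, c * k ≤ weight (factorAt x 0 (n * k)) := by
    intro k
    induction k with
    | zero => simp
    | succ k ih =>
      rw [Nat.mul_succ, factorAt_add, weight_append]
      have := hcon (0 + n * k)
      push_cast
      linarith
  refine absurd (ge_of_tendsto (tendsto_weight_mul_div h hn) ?_) (not_le.2 hc)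
  filter_upwards [eventually_gt_atTop 0] with k hk0
  rw [le_div_iff₀ (by exact_mod_cast hk0)]
  exact hk k

theorem exists_le_weight {x : ℕ → Fin 2} {α : ℝ} (h : HasUniformFreq x 1 α) {n : ℕ}
    (hn : 0 < n) {c : ℝ} (hc : c < n * α) : ∃ i, c < (weight (factorAt x i n) : ℝ) := by
  by_contra! hcon
  have hk : ∀ k : ℕ, (weight (factorAt x 0 (n * k)) : ℝ) ≤ c * k := by
    intro k
    induction k with
    | zero => simp [factorAt, weight]
    | succ k ih =>
      rw [Nat.mul_succ, factorAt_add, weight_append]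
      have := hcon (0 + n * k)
      push_cast
      linarith
  refine absurd (le_of_tendsto (tendsto_weight_mul_div h hn) ?_) (not_le.2 hc)
  filter_upwards [eventually_gt_atTop 0] with k hk0
  rw [div_le_iff₀ (by exact_mod_cast hk0)]
  exact hk k

/-- A word with uniform frequency `α` has, in each length `n`, factors of every integer weight
between `⌊n * α⌋` and `⌈n * α⌉`. -/
theorem exists_factor_weight_eq_of_freq {x : ℕ → Fin 2} {α : ℝ} (h : HasUniformFreq x 1 α)
    {n : ℕ} (hn : 0 < n) {k : ℤ} (h1 : ⌊(n : ℝ) * α⌋ ≤ k) (h2 : k ≤ ⌈(n : ℝ) * α⌉) :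
    ∃ l, (weight (factorAt x l n) : ℤ) = k := by
  obtain ⟨i, hi⟩ := exists_weight_le h hn (Int.lt_floor_add_one ((n : ℝ) * α))
  obtain ⟨j, hj⟩ := exists_le_weight h hn
    (show ((⌈(n : ℝ) * α⌉ : ℝ) - 1) < n * α by linarith [Int.ceil_lt_add_one ((n : ℝ) * α)])
  have hi' : (weight (factorAt x i n) : ℤ) < ⌊(n : ℝ) * α⌋ + 1 := by exact_mod_cast hi
  have hj' : ⌈(n : ℝ) * α⌉ - 1 < (weight (factorAt x j n) : ℤ) := by exact_mod_cast hj
  exact exists_factor_weight_eq (i := i) (j := j) (by omega) (by omega)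

theorem freq_mem_Ioo {x : ℕ → Fin 2} {α : ℝ} (hα : Irrational α) (h : HasUniformFreq x 1 α) :
    0 < α ∧ α < 1 := by
  have h0 : 0 ≤ α := ge_of_tendsto' (tendsto_weight_div h) fun n => by positivity
  have h1 : α ≤ 1 := le_of_tendsto' (tendsto_weight_div h) fun n => by
    refine div_le_one_of_le₀ ?_ n.cast_nonneg
    have := weight_le_length (factorAt x 0 n)
    rw [length_factorAt] at this
    exact_mod_cast this
  exact ⟨h0.lt_of_ne hα.ne_zero.symm, h1.lt_of_ne hα.ne_one⟩

end Weight

/-! ### Irrational rotation and the raised integer part. -/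

section Rotation

/-- Every orbit of an irrational rotation of the circle enters the arc `[0, η)` within a bounded
time. -/
theorem Irrational.exists_bounded_return {α : ℝ} (hα : Irrational α) {η : ℝ} (hη : 0 < η) :
    ∃ N : ℕ, ∀ t : ℝ, ∃ k < N, ∃ z : ℤ, (z : ℝ) ≤ t + k * α ∧ t + k * α < z + η := by
  obtain ⟨n, hn⟩ := exists_nat_one_div_lt hη
  -- By Dirichlet, `p` rotation steps amount to a nonzero displacement θ shorter than the arc, so
  -- iterating them cannot jump over it. The sign of θ decides whether the walk goes down to ⌊t⌋ or
  -- up to ⌊t⌋ + 1.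
  obtain ⟨p, hp, -, hle⟩ := Real.exists_nat_abs_mul_sub_round_le α n.succ_pos
  obtain ⟨θ, hθ⟩ : ∃ θ, θ = p * α - round (p * α) := ⟨_, rfl⟩
  have hθη : |θ| < η := by
    rw [hθ]
    refine (hle.trans ?_).trans_lt hn
    push_cast
    gcongr
    linarith
  have hθ0 : θ ≠ 0 := by
    intro h
    exact (hα.natCast_mul hp.ne').ne_int (round (p * α)) (by linarith)
  have hstep : ∀ k : ℕ, ((p * k : ℕ) : ℝ) * α = k * θ + ((k * round (p * α) : ℤ) : ℝ) := by
    intro k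
    rw [hθ]
    push_cast
    ring
  refine ⟨p * ⌈1 / |θ|⌉₊ + 1, fun t => ?_⟩
  have hf0 := Int.fract_nonneg t
  have hf1 := Int.fract_lt_one t
  have ht := Int.floor_add_fract t
  rcases lt_or_gt_of_ne hθ0 with hneg | hpos
  · rw [abs_of_neg hneg] at hθη ⊢
    have hpos : 0 < -θ := by linarith
    refine ⟨p * ⌊Int.fract t / -θ⌋₊, ?_, ⌊t⌋ + ⌊Int.fract t / -θ⌋₊ * round (p * α), ?_, ?_⟩
    · refine Nat.lt_succ_of_le (Nat.mul_le_mul_left _ ((Nat.floor_le_floor ?_).trans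
        (Nat.floor_le_ceil _)))
      gcongr
    · have := (le_div_iff₀ hpos).1 (Nat.floor_le (div_nonneg hf0 hpos.le))
      rw [hstep]
      push_cast
      linarith
    · have := (div_lt_iff₀ hpos).1 (Nat.lt_floor_add_one (Int.fract t / -θ))
      rw [hstep]
      push_cast
      linarith
  · rw [abs_of_pos hpos] at hθη ⊢
    refine ⟨p * ⌈(1 - Int.fract t) / θ⌉₊, ?_,
      ⌊t⌋ + 1 + ⌈(1 - Int.fract t) / θ⌉₊ * round (p * α), ?_, ?_⟩
    · refine Nat.lt_succ_of_le (Nat.mul_le_mul_left _ (Nat.ceil_le_ceil ?_))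
      gcongr
      linarith
    · have := (div_le_iff₀ hpos).1 (Nat.le_ceil ((1 - Int.fract t) / θ))
      rw [hstep]
      push_cast
      linarith
    · have := Nat.ceil_lt_add_one (div_nonneg (sub_nonneg.2 hf1.le) hpos.le : 0 ≤ (1 - Int.fract t) / θ)
      have := (lt_div_iff₀ hpos).1 (sub_lt_iff_lt_add.2 this)
      rw [hstep]
      push_cast
      linarith

/-- The integer part, raised by one on the arc `[u, v)`. -/
noncomputable def raisedFloor (u v t : ℝ) : ℤ :=
  ⌊t⌋ + if u ≤ Int.fract t ∧ Int.fract t < v then 1 else 0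

theorem raisedFloor_add_int (u v t : ℝ) (z : ℤ) :
    raisedFloor u v (t + z) = raisedFloor u v t + z := by
  simp only [raisedFloor, Int.floor_add_intCast, Int.fract_add_intCast]
  ring

theorem lt_raisedFloor (u v t : ℝ) : t - 1 < raisedFloor u v t := by
  have := Int.lt_floor_add_one t
  unfold raisedFloor
  split_ifs <;> push_cast <;> linarith

theorem raisedFloor_le {u : ℝ} (hu : u ≤ 1) (v t : ℝ) :
    (raisedFloor u v t : ℝ) ≤ t + 1 - u := by
  have h1 := Int.floor_add_fract t
  have h2 := Int.fract_nonneg t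
  unfold raisedFloor
  split_ifs with h
  · push_cast
    linarith [h.1]
  · push_cast
    linarith

/-- All the arcs cut out by 0, u, v are closed on the left and open on the right. -/
theorem raisedFloor_right_const {u v : ℝ} (hu : u ≤ 1) (hv : v ≤ 1) (t : ℝ) :
    ∃ η > 0, ∀ e, 0 ≤ e → e < η → raisedFloor u v (t + e) = raisedFloor u v t := by
  have h1 := Int.floor_add_fract t
  have h0 := Int.fract_nonneg t
  have h2 := Int.fract_lt_one t
  have key : ∀ e, 0 ≤ e → e < 1 - Int.fract t →
      ⌊t + e⌋ = ⌊t⌋ ∧ Int.fract (t + e) = Int.fract t + e := by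
    intro e he0 he1
    have hfl : ⌊t + e⌋ = ⌊t⌋ := by
      rw [Int.floor_eq_iff]
      constructor <;> linarith
    refine ⟨hfl, ?_⟩
    have := Int.floor_add_fract (t + e)
    rw [hfl] at this
    linarith
  unfold raisedFloor
  by_cases hfu : Int.fract t < u
  · refine ⟨u - Int.fract t, by linarith, fun e he0 he1 => ?_⟩
    obtain ⟨ha, hb⟩ := key e he0 (by linarith)
    rw [ha, hb, if_neg (fun h => absurd h.1 (by linarith)),
      if_neg (fun h => absurd h.1 (by linarith))]
  · by_cases hfv : Int.fract t < v
    · refine ⟨v - Int.fract t, by linarith, fun e he0 he1 => ?_⟩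
      obtain ⟨ha, hb⟩ := key e he0 (by linarith)
      rw [ha, hb, if_pos ⟨by linarith, by linarith⟩, if_pos ⟨by linarith, by linarith⟩]
    · refine ⟨1 - Int.fract t, by linarith, fun e he0 he1 => ?_⟩
      obtain ⟨ha, hb⟩ := key e he0 (by linarith)
      rw [ha, hb, if_neg (fun h => absurd h.2 (by linarith)),
        if_neg (fun h => absurd h.2 (by linarith))]

theorem raisedFloor_right_const_of_lt {u v : ℝ} (hu : u ≤ 1) (hv : v ≤ 1) (α t : ℝ) (n : ℕ) :
    ∃ η > 0, ∀ e, 0 ≤ e → e < η → ∀ m < n,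
      raisedFloor u v (t + m * α + e) = raisedFloor u v (t + m * α) := by
  induction n with
  | zero => exact ⟨1, one_pos, fun e _ _ m hm => absurd hm (Nat.not_lt_zero m)⟩
  | succ n ih =>
    obtain ⟨η, hη, h⟩ := ih
    obtain ⟨η', hη', h'⟩ := raisedFloor_right_const hu hv (t + n * α)
    refine ⟨min η η', lt_min hη hη', fun e he0 he1 m hm => ?_⟩
    rcases Nat.lt_succ_iff_lt_or_eq.1 hm with hm | rfl
    · exact h e he0 (he1.trans_le (min_le_left _ _)) m hm
    · exact h' e he0 (he1.trans_le (min_le_right _ _))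

/-- If `d` is farther than `1 - u` from the integers then the increments of `raisedFloor u v` over
the length `d` are those of a translate of the integer part. -/
theorem raisedFloor_increment {u v d : ℝ} (hu : u ≤ 1) (h1 : 1 - u < Int.fract d)
    (h2 : Int.fract d < u) (t : ℝ) :
    ⌊d⌋ ≤ raisedFloor u v (t + d) - raisedFloor u v t ∧
      raisedFloor u v (t + d) - raisedFloor u v t ≤ ⌊d⌋ + 1 := by
  have hd := Int.floor_add_fract d
  have ht := Int.floor_add_fract t
  have ht0 := Int.fract_nonneg t
  have ht1 := Int.fract_lt_one t
  have hs := Int.floor_add_fract (t + d)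
  have hs0 := Int.fract_nonneg (t + d)
  have hs1 := Int.fract_lt_one (t + d)
  have hcarry : ⌊t + d⌋ = ⌊t⌋ + ⌊d⌋ ∨ ⌊t + d⌋ = ⌊t⌋ + ⌊d⌋ + 1 := by
    have e1 : ⌊t⌋ + ⌊d⌋ < ⌊t + d⌋ + 1 := by
      exact_mod_cast (by linarith [Int.fract_nonneg d] : (⌊t⌋ : ℝ) + ⌊d⌋ < ⌊t + d⌋ + 1)
    have e2 : ⌊t + d⌋ < ⌊t⌋ + ⌊d⌋ + 2 := by
      exact_mod_cast (by linarith : (⌊t + d⌋ : ℝ) < ⌊t⌋ + ⌊d⌋ + 2)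
    omega
  unfold raisedFloor
  -- Without a carry, t cannot be raised: its fractional part plus that of d would exceed 1. With a
  -- carry, t + d cannot be raised: its fractional part is below that of d, hence below u.
  rcases hcarry with hc | hc <;> rw [hc] at hs ⊢ <;> push_cast at hs <;>
    split_ifs with ha hb hb <;> first
      | exact ⟨by omega, by omega⟩
      | exact absurd ha.1 (by linarith)
      | exact absurd hb.1 (by linarith)

end Rotation

/-! ### The coded words: recurrence, weights and separation by excess. -/

section CodedWord

/-- The binary word of increments of `raisedFloor u v` along the multiples of `α`. -/
noncomputable def rotationWord (u v α : ℝ) (m : ℕ) : Fin 2 :=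
  if raisedFloor u v (m * α + α) = raisedFloor u v (m * α) + 1 then 1 else 0

theorem rotationWord_uniformlyRecurrent {u v α : ℝ} (hα : Irrational α) (hu : u ≤ 1)
    (hv : v ≤ 1) : UniformlyRecurrent (rotationWord u v α) := by
  rintro _ ⟨i, n, rfl⟩
  -- The `n` letters are increments between `n + 1` values.
  obtain ⟨η, hη, h⟩ := raisedFloor_right_const_of_lt hu hv α (i * α) (n + 1)
  obtain ⟨N, hN⟩ := hα.exists_bounded_return hη
  refine ⟨N + n, fun w hw => ?_⟩
  obtain ⟨j, rfl⟩ := mem_languageOfLength.1 hw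
  -- After `k` steps the orbit of jα lies, modulo 1, just to the right of iα, where the same letters
  -- are read.
  obtain ⟨k, hk, z, hz0, hz1⟩ := hN (j * α - i * α)
  have hval : ∀ m < n + 1, raisedFloor u v (((j + k + m : ℕ) : ℝ) * α) =
      raisedFloor u v (((i + m : ℕ) : ℝ) * α) + z := by
    intro m hm
    have e1 : ((j + k + m : ℕ) : ℝ) * α =
        i * α + m * α + (j * α - i * α + k * α - z) + z := by
      push_cast; ring
    have e2 : ((i + m : ℕ) : ℝ) * α = i * α + m * α := by push_cast; ring
    rw [e1, e2, raisedFloor_add_int, h _ (by linarith) (by linarith) m hm]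
  have heq : factorAt (rotationWord u v α) i n = factorAt (rotationWord u v α) (j + k) n := by
    refine factorAt_congr fun m hm => ?_
    have a1 := hval m (by omega)
    have a2 := hval (m + 1) (by omega)
    have e : ∀ a : ℕ, ((a : ℕ) : ℝ) * α + α = ((a + 1 : ℕ) : ℝ) * α := fun a => by
      push_cast; ring
    unfold rotationWord
    rw [e, e, a1, Nat.add_assoc (j + k), a2, Nat.add_assoc i]
    congr 1
    exact propext ⟨fun h => by omega, fun h => by omega⟩
  rw [heq]
  exact factorAt_infix _ (by omega) (by omega)

theorem weight_rotationWord {u v α : ℝ} (hu : u ≤ 1) (h0 : 1 - u < α) (h1 : α < u) (i n : ℕ) :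
    (weight (factorAt (rotationWord u v α) i n) : ℤ) =
      raisedFloor u v (i * α + n * α) - raisedFloor u v (i * α) := by
  have hfr : Int.fract α = α := Int.fract_eq_self.2 ⟨by linarith, by linarith⟩
  have hfl : ⌊α⌋ = 0 := Int.floor_eq_zero_iff.2 ⟨by linarith, by linarith⟩
  induction n with
  | zero => simp [factorAt, weight]
  | succ n ih =>
    have e1 : (i : ℝ) * α + ((n + 1 : ℕ) : ℝ) * α = ((i + n : ℕ) : ℝ) * α + α := by
      push_cast; ring
    have e2 : (i : ℝ) * α + (n : ℝ) * α = ((i + n : ℕ) : ℝ) * α := by push_cast; ring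
    have hst := raisedFloor_increment (v := v) hu (by rwa [hfr]) (by rwa [hfr])
      (((i + n : ℕ) : ℝ) * α)
    rw [hfl] at hst
    rw [e2] at ih
    have hlast : rotationWord u v α (i + n) = if raisedFloor u v (((i + n : ℕ) : ℝ) * α + α) =
        raisedFloor u v (((i + n : ℕ) : ℝ) * α) + 1 then 1 else 0 := rfl
    rw [factorAt_add, weight_append, weight_factorAt_one, e1, hlast]
    rw [Nat.cast_add, ih]
    split_ifs with ha hb hb
    · omega
    · exact absurd rfl hb
    · exact absurd hb (by decide)
    · omega

/-- The excess of weight of the factors of `rotationWord u v α` is bounded by `2 - u`. -/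
theorem weight_rotationWord_lt {u v α : ℝ} (hu : u ≤ 1) (h0 : 1 - u < α) (h1 : α < u)
    {w : List (Fin 2)} (hw : w ∈ language (rotationWord u v α)) :
    (weight w : ℝ) - w.length * α < 2 - u := by
  obtain ⟨i, n, rfl⟩ := hw
  have h := congrArg (Int.cast : ℤ → ℝ) (weight_rotationWord (v := v) hu h0 h1 i n)
  push_cast at h
  rw [length_factorAt, h]
  linarith [raisedFloor_le hu v (i * α + n * α), lt_raisedFloor u v (i * α)]

/-- The bound `2 - u` for the excess of weight is approached. -/
theorem exists_lt_weight_rotationWord {u v α : ℝ} (hα : Irrational α) (huv : u < v) (hv : v < 1)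
    (h0 : 1 - u < α) (h1 : α < u) {c : ℝ} (hc : c < 2 - u) :
    ∃ w ∈ language (rotationWord u v α), c < (weight w : ℝ) - w.length * α := by
  obtain ⟨ε, hε, hε1, hε2, hε3⟩ : ∃ ε > 0, ε < v - u ∧ ε < 1 - v ∧ 2 * ε < 2 - u - c := by
    refine ⟨min (v - u) (min (1 - v) (2 - u - c)) / 3, ?_, ?_, ?_, ?_⟩
    · have : 0 < min (v - u) (min (1 - v) (2 - u - c)) :=
        lt_min (by linarith) (lt_min (by linarith) (by linarith))
      positivity
    all_goals
      have a0 : 0 < min (v - u) (min (1 - v) (2 - u - c)) :=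
        lt_min (by linarith) (lt_min (by linarith) (by linarith))
      have a1 := min_le_left (v - u) (min (1 - v) (2 - u - c))
      have a2 := (min_le_right (v - u) (min (1 - v) (2 - u - c))).trans (min_le_left _ _)
      have a3 := (min_le_right (v - u) (min (1 - v) (2 - u - c))).trans (min_le_right _ _)
      linarith
  obtain ⟨N, hN⟩ := hα.exists_bounded_return hε
  -- Start with fractional part in [1 - ε, 1), beyond v, where F(t) - t is near -1; end with it in
  -- [u, u + ε), inside the raised arc, where F(t) - t is near 1 - u. The total loss is below 2ε.
  obtain ⟨i, -, z, hz0, hz1⟩ := hN (-(1 - ε))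
  obtain ⟨n, -, y, hy0, hy1⟩ := hN (i * α - u)
  have fi : ⌊(i : ℝ) * α⌋ = z := Int.floor_eq_iff.2 ⟨by linarith, by linarith⟩
  have fj : ⌊(i : ℝ) * α + n * α⌋ = y := Int.floor_eq_iff.2 ⟨by linarith, by linarith⟩
  have ri := Int.floor_add_fract ((i : ℝ) * α)
  have rj := Int.floor_add_fract ((i : ℝ) * α + n * α)
  rw [fi] at ri
  rw [fj] at rj
  have h := congrArg (Int.cast : ℤ → ℝ)
    (weight_rotationWord (v := v) (by linarith) h0 h1 i n)
  unfold raisedFloor at h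
  rw [fi, fj, if_pos ⟨by linarith, by linarith⟩, if_neg (fun h => absurd h.2 (by linarith))] at h
  push_cast at h
  refine ⟨_, factorAt_mem_language _ i n, ?_⟩
  rw [length_factorAt, h]
  linarith

theorem not_subset_language_rotationWord {u u' v α : ℝ} (hα : Irrational α) (huu : u < u')
    (huv : u' < v) (hv : v < 1) (h0 : 1 - u < α) (h1 : α < u) :
    ¬ language (rotationWord u v α) ⊆ language (rotationWord u' v α) := by
  intro hsub
  obtain ⟨w, hw, hc⟩ := exists_lt_weight_rotationWord hα (huu.trans huv) hv h0 h1
    (show 2 - u' < 2 - u by linarith)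
  exact absurd (weight_rotationWord_lt (by linarith) (by linarith) (by linarith) (hsub hw))
    (not_lt.2 hc.le)

theorem subshiftOfWord_rotationWord_injOn {v α a : ℝ} (hα : Irrational α) (hv : v < 1)
    (h0 : 1 - a ≤ α) (h1 : α ≤ a) :
    Set.InjOn (fun u => subshiftOfWord (rotationWord u v α)) (Set.Ioo a v) := by
  have key : ∀ u ∈ Set.Ioo a v, ∀ u' ∈ Set.Ioo a v, u < u' →
      subshiftOfWord (rotationWord u v α) ≠ subshiftOfWord (rotationWord u' v α) := by
    intro u hu u' hu' hlt heq
    refine not_subset_language_rotationWord hα hlt hu'.2 hv (by linarith [hu.1])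
      (by linarith [hu.1]) ?_
    have := self_mem_subshiftOfWord (rotationWord u v α)
    rw [heq] at this
    exact this
  intro u hu u' hu' heq
  rcases lt_trichotomy u u' with h | h | h
  · exact absurd heq (key u hu u' hu' h)
  · exact h
  · exact absurd heq.symm (key u' hu' u hu h)

/-- The first multiples of an irrational number stay away from the integers. -/
theorem Irrational.exists_fract_mul_mem {α : ℝ} (hα : Irrational α) (N : ℕ) :
    ∃ δ > 0, δ < 1 ∧ ∀ n : ℕ, 0 < n → n ≤ N →
      δ ≤ Int.fract (n * α) ∧ Int.fract (n * α) ≤ 1 - δ := by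
  induction N with
  | zero => exact ⟨1 / 2, by norm_num, by norm_num, fun n h1 h2 => by omega⟩
  | succ N ih =>
    obtain ⟨δ, hδ, hδ1, h⟩ := ih
    have hirr : Irrational (((N + 1 : ℕ) : ℝ) * α) := hα.natCast_mul N.succ_ne_zero
    have hpos : 0 < Int.fract (((N + 1 : ℕ) : ℝ) * α) := by
      refine (Int.fract_nonneg _).lt_of_ne fun h => ?_
      have := Int.floor_add_fract (((N + 1 : ℕ) : ℝ) * α)
      rw [← h, add_zero] at this
      exact hirr.ne_int _ this.symm
    have hlt := Int.fract_lt_one (((N + 1 : ℕ) : ℝ) * α)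
    refine ⟨min δ (min (Int.fract (((N + 1 : ℕ) : ℝ) * α)) (1 - Int.fract (((N + 1 : ℕ) : ℝ) * α))),
      lt_min hδ (lt_min hpos (by linarith)), (min_le_left _ _).trans_lt hδ1, fun n hn0 hn => ?_⟩
    have a1 := min_le_left δ
      (min (Int.fract (((N + 1 : ℕ) : ℝ) * α)) (1 - Int.fract (((N + 1 : ℕ) : ℝ) * α)))
    have a2 := (min_le_right δ (min (Int.fract (((N + 1 : ℕ) : ℝ) * α))
      (1 - Int.fract (((N + 1 : ℕ) : ℝ) * α)))).trans (min_le_left _ _)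
    have a3 := (min_le_right δ (min (Int.fract (((N + 1 : ℕ) : ℝ) * α))
      (1 - Int.fract (((N + 1 : ℕ) : ℝ) * α)))).trans (min_le_right _ _)
    rcases Nat.le_succ_iff.1 hn with hn | rfl
    · obtain ⟨b1, b2⟩ := h n hn0 hn
      exact ⟨a1.trans b1, by linarith⟩
    · exact ⟨a2, by linarith⟩

end CodedWord

/-! ### Membership in the abelian closure and the uncountable family. -/

theorem rotationWord_mem_abelianClosure {x : ℕ → Fin 2} {α u : ℝ} (v : ℝ) {n₀ : ℕ}
    (hfreq : HasUniformFreq x 1 α)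
    (hwide : ∀ n : ℕ, n₀ ≤ n →
      (∃ v ∈ languageOfLength x n, (weight v : ℤ) = ⌈(n : ℝ) * α⌉ + 1) ∧
      (∃ v ∈ languageOfLength x n, (weight v : ℤ) = ⌊(n : ℝ) * α⌋ - 1))
    (hu : u ≤ 1) (h0 : 1 - u < α) (h1 : α < u)
    (hshort : ∀ n : ℕ, 0 < n → n < n₀ → 1 - u < Int.fract (n * α) ∧ Int.fract (n * α) < u) :
    rotationWord u v α ∈ abelianClosure x := by
  refine mem_abelianClosure_of_weight fun i n => ?_
  suffices h : ∃ l, (weight (factorAt x l n) : ℤ) =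
      (weight (factorAt (rotationWord u v α) i n) : ℤ) by exact_mod_cast h
  rw [weight_rotationWord hu h0 h1]
  rcases Nat.eq_zero_or_pos n with rfl | hn
  · exact ⟨0, by simp [factorAt, weight]⟩
  by_cases hn0 : n < n₀
  · obtain ⟨b1, b2⟩ := hshort n hn hn0
    obtain ⟨c1, c2⟩ := raisedFloor_increment (v := v) hu b1 b2 (i * α)
    refine exists_factor_weight_eq_of_freq hfreq hn c1 (c2.trans ?_)
    have := Int.floor_add_fract ((n : ℝ) * α)
    exact Int.add_one_le_iff.2 (Int.lt_ceil.2 (by linarith))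
  · obtain ⟨⟨w, hw, hwt⟩, w', hw', hwt'⟩ := hwide n (not_lt.1 hn0)
    obtain ⟨j, rfl⟩ := mem_languageOfLength.1 hw
    obtain ⟨j', rfl⟩ := mem_languageOfLength.1 hw'
    have a1 := lt_raisedFloor u v (i * α)
    have a2 := lt_raisedFloor u v (i * α + n * α)
    have a3 := raisedFloor_le hu v (i * α)
    have a4 := raisedFloor_le hu v (i * α + n * α)
    have a5 := Int.floor_le ((n : ℝ) * α)
    have a6 := Int.le_ceil ((n : ℝ) * α)
    refine exists_factor_weight_eq (i := j') (j := j) ?_ ?_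
    · rw [hwt']
      have : ⌊(n : ℝ) * α⌋ - 2 < raisedFloor u v (i * α + n * α) - raisedFloor u v (i * α) := by
        have : (⌊(n : ℝ) * α⌋ : ℝ) - 2 <
          raisedFloor u v (i * α + n * α) - raisedFloor u v (i * α) := by linarith
        exact_mod_cast this
      omega
    · rw [hwt]
      have : raisedFloor u v (i * α + n * α) - raisedFloor u v (i * α) < ⌈(n : ℝ) * α⌉ + 2 := by
        have : (raisedFloor u v (i * α + n * α) : ℝ) - raisedFloor u v (i * α) <
          ⌈(n : ℝ) * α⌉ + 2 := by linarith
        exact_mod_cast this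
      omega

theorem mainTheorem10 (x : ℕ → Fin 2) (α : ℝ)
    (hx : UniformlyRecurrent x)
    (hα : Irrational α)
    (hfreq : HasUniformFreq x 1 α)
    (hwide : ∃ n₀ : ℕ, ∀ n : ℕ, n₀ ≤ n →
      (∃ v ∈ languageOfLength x n, (weight v : ℤ) = ⌈(n : ℝ) * α⌉ + 1) ∧
      (∃ v ∈ languageOfLength x n, (weight v : ℤ) = ⌊(n : ℝ) * α⌋ - 1)) :
    ¬ Set.Countable
      {X : Subshift (Fin 2) ℕ | IsMinimalSubshift X ∧ X.carrier ⊆ abelianClosure x} := by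
  obtain ⟨n₀, hwide⟩ := hwide
  obtain ⟨hα0, hα1⟩ := freq_mem_Ioo hα hfreq
  -- The bound n₀ + 1 ensures that n = 1 is included even when n₀ = 0, so that δ ≤ α ≤ 1 - δ.
  obtain ⟨δ, hδ, hδ1, hfr⟩ := hα.exists_fract_mul_mem (n₀ + 1)
  obtain ⟨b1, b2⟩ := hfr 1 one_pos (by omega)
  rw [Nat.cast_one, one_mul, Int.fract_eq_self.2 ⟨hα0.le, hα1⟩] at b1 b2
  intro hcount
  -- Here u > 1 - δ handles the short lengths, while the fixed v = 1 - δ/2 stays above u and below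
  -- 1, as the separation of parameters requires.
  have hIoo : (Set.Ioo (1 - δ) (1 - δ / 2)).Countable := by
    refine Set.MapsTo.countable_of_injOn ?_
      (subshiftOfWord_rotationWord_injOn (v := 1 - δ / 2) hα (by linarith) (by linarith) b2)
      hcount
    rintro u ⟨hu1, hu2⟩
    refine ⟨(rotationWord_uniformlyRecurrent hα (by linarith) (by linarith)).isMinimalSubshift,
      subshiftOfWord_subset_abelianClosure
        (rotationWord_mem_abelianClosure _ hfreq hwide (by linarith) (by linarith) (by linarith)
          fun n hn hn0 => ?_)⟩
    obtain ⟨c1, c2⟩ := hfr n hn (by omega)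
    exact ⟨by linarith, by linarith⟩
  exact absurd (Cardinal.Real.Ioo_countable_iff.1 hIoo) (by linarith)
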